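/- **Games.** Let $V$ be a locally finite directed graph (every vertex has finite out-degree); $\Gamma(x)$ denotes the set of out-neighbours (options) of $x$. Two players alternately move from the current position $x$ to some $y\in\Gamma(x)$; a player who has no move loses, and play may go on for ever. A position is a *draw* if neither player has a winning strategy from it. Define $\mathcal G_0(x)=0$ if $\Gamma(x)=\emptyset$ and $\mathcal G_0(x)=\infty$ otherwise. For $n\ge 1$ let $m=\operatorname{mex}\{\mathcal G_{n-1}(y):y\in\Gamma(x)\}$ (the least natural number not in the set), and put $\mathcal G_n(x)=m$ if for each $y\in\Gamma(x)$ either $\mathcal G_{n-1}(y)\le m$ or there is $z\in\Gamma(y)$ with $\mathcal G_{n-1}(z)=m$; otherwise put $\mathcal G_n(x)=\infty$. The extended Sprague–Grundy value is $\mathcal G(x)=m\in\mathbb N=\{0,1,2,\dots\}$ if $\mathcal G_n(x)=m$ for all sufficiently large $n$, and, if there is no such $m$, it is $\mathcal G(x)=\infty(\mathcal A)$ with $\mathcal A=\{a\in\mathbb N:\mathcal G(y)=a\text{ for some }y\in\Gamma(x)\}$. For $k\ge 0$, the graph $V$ is *$k$-stable* if $\{0,1,\dots,k\}\subseteq\mathcal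 A$ whenever $x\in V$ and $\mathcal G(x)=\infty(\mathcal A)$. **Proposition.** Let $T$ be a Galton–Watson tree with root $o$ and offspring distribution $(p_j)_{j\in\mathbb N}$, where $p_0>0$, regarded as a directed graph with an arc from each parent to each of its children. Say that the vertex degrees are *unbounded* if $\{j:p_j>0\}$ is unbounded, and that the *maximum out-degree is $d$* if $d=\sup\{j:p_j>0\}<\infty$. (a) Suppose that $o$ is a draw with positive probability. 1. If the vertex degrees are unbounded, then $\mathbb P(\mathcal G(o)=\infty(\mathcal A))>0$ for every finite $\mathcal A\subset\mathbb N$. 2. If the maximum out-degree is $d$, then for $\mathcal A\subseteq\mathbb N$ we have $\mathbb P(\mathcal G(o)=\infty(\mathcal A))>0$ if and only if $\mathcal A\subseteq\{0,1,\dots,d\}$ and $|\mathcal A|\le d-1$. (b) Let $k\ge1$, and suppose that $T$ is $(k-1)$-stable with probability $1$ but has positive probability not to be $k$-stable. 1. If the vertex degrees are unbounded, then $\mathbb P(\mathcal G(o)=\infty(\mathcal A))>0$ for every finite $\mathcal A\subset\mathbb N$ with $\{0,\dots,k-1\}\subseteq\mathcal A$. 2. If the maximum out-degree is $d$, then for $\mathcal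 A\subseteq\mathbb N$ we have $\mathbb P(\mathcal G(o)=\infty(\mathcal A))>0$ if and only if $\{0,\dots,k-1\}\subseteq\mathcal A\subseteq\{0,1,\dots,d\}$ and $|\mathcal A|\le d-1$. -/

import Mathlib

open MeasureTheory ProbabilityTheory Filter

/-! ### Games on directed graphs

Positions are the vertices of a directed graph, the options of `x` are its out-neighbours, and a
player who has no move loses. -/

namespace LoopyGame

variable {V : Type*}

/-- A position is terminal if it has no options. -/
def IsTerminal (G : Digraph V) (x : V) : Prop := ∀ y, ¬ G.Adj x y

/-! #### Strategies and outcomes -/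

/-- A (history-dependent) strategy: given the list of all positions visited so far, in order, the
last one being the current position, it names the next position. -/
abbrev Strategy (V : Type*) := List V → V

/-- The positions `w 0, …, w i`. -/
def history (w : ℕ → V) (i : ℕ) : List V := (List.range (i + 1)).map w

/-- `w 0, …, w n` is a play of `n` legal moves started at `x` in which the player who makes the
moves number `i` (counted from `0`) with `i % 2 = b` follows `σ`. So `b = 0` is the first player
and `b = 1` is the second player. -/
def IsPlayFollowing (G : Digraph V) (x : V) (b : ℕ) (σ : Strategy V) (w : ℕ → V) (n : ℕ) : Prop :=
  w 0 = x ∧ ∀ i < n, G.Adj (w i) (w (i + 1)) ∧ (i % 2 = b → w (i + 1) = σ (history w i))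

/-- `σ` wins for player `b` from `x`: whenever this player is to move (having followed `σ` so far),
`σ` gives a legal move, and no play in which the player follows `σ` goes on for ever. Hence each
play ends in a terminal position with the opponent to move. -/
def IsWinning (G : Digraph V) (x : V) (b : ℕ) (σ : Strategy V) : Prop :=
  (∀ (w : ℕ → V) (n : ℕ), IsPlayFollowing G x b σ w n → n % 2 = b →
    G.Adj (w n) (σ (history w n))) ∧
  ∀ w : ℕ → V, ¬ ∀ n, IsPlayFollowing G x b σ w n

def FirstPlayerWins (G : Digraph V) (x : V) : Prop := ∃ σ, IsWinning G x 0 σ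

def SecondPlayerWins (G : Digraph V) (x : V) : Prop := ∃ σ, IsWinning G x 1 σ

/-- A draw: neither player has a winning strategy. -/
def IsDraw (G : Digraph V) (x : V) : Prop := ¬ FirstPlayerWins G x ∧ ¬ SecondPlayerWins G x

/-! #### The extended Sprague-Grundy function (of a locally finite graph) -/

/-- The least natural number that is not in `S`. -/
noncomputable def mex (S : Set ℕ∞) : ℕ := sInf {m : ℕ | (m : ℕ∞) ∉ S}

open Classical in
/-- The recursively defined approximations of the Sprague-Grundy function; `⊤` stands for `∞`. -/
noncomputable def sgApprox (G : Digraph V) : ℕ → V → ℕ∞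
  | 0, x => if IsTerminal G x then 0 else ⊤
  | n + 1, x =>
    let m : ℕ := mex {a | ∃ y, G.Adj x y ∧ sgApprox G n y = a}
    if ∀ y, G.Adj x y → sgApprox G n y ≤ m ∨ ∃ z, G.Adj y z ∧ sgApprox G n z = m
    then m else ⊤

/-- The approximations at `x` are equal to the natural number `m` from some point on. -/
def HasNimValue (G : Digraph V) (x : V) (m : ℕ) : Prop :=
  ∀ᶠ n in atTop, sgApprox G n x = (m : ℕ∞)

/-- Extended Sprague-Grundy values: a natural number `m`, or `∞(A)`. -/
inductive SGValue where
  | nim (m : ℕ)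
  | infty (A : Set ℕ)

open Classical in
/-- The extended Sprague-Grundy function. -/
noncomputable def sg (G : Digraph V) (x : V) : SGValue :=
  if h : ∃ m, HasNimValue G x m then .nim h.choose
  else .infty {a | ∃ y, G.Adj x y ∧ HasNimValue G y a}

/-- `k`-stability: if `x` has infinite rank, with value `∞(A)`, then `{0, …, k} ⊆ A`. -/
def IsStable (G : Digraph V) (k : ℕ) : Prop :=
  ∀ (x : V) (A : Set ℕ), sg G x = .infty A → Set.Iic k ⊆ A

end LoopyGame

/-! ### Galton-Watson trees -/

namespace GaltonWatson

/-- The vertices, in Ulam-Harris labelling, of the tree in which an individual `v` has `c v`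
children `v ++ [0], …, v ++ [c v - 1]`. The root is `[]`. -/
def vertices (c : List ℕ → ℕ) : Set (List ℕ) :=
  {u | ∀ (v : List ℕ) (i : ℕ), v ++ [i] <+: u → i < c v}

/-- The tree as a directed graph, with arcs from parents to children. -/
def tree (c : List ℕ → ℕ) : Digraph (vertices c) where
  Adj u v := ∃ i : ℕ, (v : List ℕ) = (u : List ℕ) ++ [i]

def root (c : List ℕ → ℕ) : vertices c :=
  ⟨[], fun v i h => absurd (List.prefix_nil.mp h) (by simp)⟩

/-- The family sizes `ξ v` are independent and have the offspring distribution `p`; then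
`tree (fun v => ξ v ω)` is a Galton-Watson tree with offspring distribution `p`. -/
structure IsOffspringFamily {Ω : Type*} [MeasurableSpace Ω] (P : Measure Ω) (p : PMF ℕ)
    (ξ : List ℕ → Ω → ℕ) : Prop where
  measurable : ∀ v, Measurable (ξ v)
  law : ∀ v, P.map (ξ v) = p.toMeasure
  indep : iIndepFun ξ P

/-- Unbounded vertex degrees. -/
def HasUnboundedDegrees (p : PMF ℕ) : Prop := ¬ BddAbove {k : ℕ | 0 < p k}

/-- The maximum out-degree `sup {k | 0 < p k}` is finite and equal to `d`. -/
def HasMaxOutDegree (p : PMF ℕ) (d : ℕ) : Prop := IsLUB {k : ℕ | 0 < p k} d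

end GaltonWatson

/-! The limit values satisfy a local criterion, `hasNimValue_iff`: `x` has value `m` iff `m` is the
mex of the finite values of its options, and each option either has a value at most `m` or has
itself an option of value `m`. An option of finite value above `m` always has an option of value
`m`. Hence `x` has infinite rank iff, for the mex `m` of the values of its options, some option of
infinite rank has no option of value `m`.

Necessity. Value `m` requires children of values `0, …, m - 1`, so values are at most `d`; a vertex
of infinite rank has a child of infinite rank, which leaves at most `d - 1` children to carry
values.

Sufficiency (`inftyEvent_pos`). Prescribing the root degree and independent events in the subtrees
of the children shows that every `m` not exceeding some possible degree is a value with positive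
probability. Failure of `k`-stability yields a finite `B` with `k ∉ B` such that `∞(B)` has positive
probability. Children with values `0, …, k - 1`, the others `∞(B)`, produce `∞({0, …, k - 1})`.
Children with the values in `F ⊇ {0, …, k - 1}`, the others `∞({0, …, k - 1})`, then produce `∞(F)`,
since the mex of `F` is at least `k`.

Part (a) is the case `k = 0`: a draw has infinite rank and no option of value `0`. -/

namespace LoopyGame

/-! ### The limit of the approximations and the criterion for infinite rank -/

variable {V W : Type*} {G : Digraph V} {H : Digraph W}

theorem mex_eq_iff {S : Set ℕ∞} (hS : S.Finite) (m : ℕ) :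
    mex S = m ↔ (∀ k < m, (k : ℕ∞) ∈ S) ∧ (m : ℕ∞) ∉ S := by
  have hne : {m : ℕ | (m : ℕ∞) ∉ S}.Nonempty := by
    by_contra h
    have hsub : Set.range ((↑) : ℕ → ℕ∞) ⊆ S := by
      rintro _ ⟨n, rfl⟩
      by_contra hn
      exact h ⟨n, hn⟩
    exact Set.infinite_range_of_injective Nat.cast_injective (hS.subset hsub)
  constructor
  · rintro rfl
    exact ⟨fun k hk => not_not.mp fun h => Nat.notMem_of_lt_sInf hk h, Nat.sInf_mem hne⟩
  · rintro ⟨h₁, h₂⟩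
    refine le_antisymm (Nat.sInf_le h₂) (le_of_not_gt fun hlt => ?_)
    exact Nat.sInf_mem hne (h₁ _ hlt)

theorem sgApprox_succ_eq_iff {x : V} (hx : {y | G.Adj x y}.Finite) (n m : ℕ) :
    sgApprox G (n + 1) x = m ↔
      (∀ k < m, ∃ y, G.Adj x y ∧ sgApprox G n y = k) ∧
      (∀ y, G.Adj x y → sgApprox G n y ≠ m) ∧
      ∀ y, G.Adj x y → sgApprox G n y ≤ m ∨ ∃ z, G.Adj y z ∧ sgApprox G n z = m := by
  have hfin : {a | ∃ y, G.Adj x y ∧ sgApprox G n y = a}.Finite := by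
    refine (hx.image (sgApprox G n)).subset ?_
    rintro a ⟨y, hy, rfl⟩
    exact ⟨y, hy, rfl⟩
  have hmex := mex_eq_iff hfin m
  rw [sgApprox]
  constructor
  · intro h
    split_ifs at h with hc
    · have hm := Nat.cast_injective h
      rw [hm] at hc
      obtain ⟨h₁, h₂⟩ := hmex.mp hm
      exact ⟨h₁, fun y hy hy' => h₂ ⟨y, hy, hy'⟩, hc⟩
    · exact absurd h.symm (ENat.natCast_ne_top m)
  · rintro ⟨h₁, h₂, h₃⟩
    have hm := hmex.mpr ⟨h₁, fun ⟨y, hy, hy'⟩ => h₂ y hy hy'⟩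
    rw [if_pos (by rw [hm]; exact h₃), hm]

theorem sgApprox_zero_eq_iff (x : V) (m : ℕ) :
    sgApprox G 0 x = m ↔ IsTerminal G x ∧ m = 0 := by
  rw [sgApprox]
  split_ifs with h
  · simp [h, eq_comm]
  · simp [h]

/-- Every vertex has finitely many options. -/
def LocallyFinite (G : Digraph V) : Prop := ∀ x, {y | G.Adj x y}.Finite

/-- The delicate point is that no option `y` newly acquires the value `m`. If `y` had a value at
most `m`, that value persists and was not `m`; otherwise `y` has an option of value `m`, which bars
`y` from the value `m`. -/
theorem sgApprox_succ_of_eq (hG : LocallyFinite G) {n m : ℕ} {x : V}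
    (h : sgApprox G n x = m) : sgApprox G (n + 1) x = m := by
  induction n generalizing x m with
  | zero =>
    obtain ⟨ht, rfl⟩ := (sgApprox_zero_eq_iff x m).mp h
    rw [sgApprox_succ_eq_iff (hG x)]
    exact ⟨by simp, fun y hy => absurd hy (ht y), fun y hy => absurd hy (ht y)⟩
  | succ n ih =>
    obtain ⟨h₁, h₂, h₃⟩ := (sgApprox_succ_eq_iff (hG x) n m).mp h
    rw [sgApprox_succ_eq_iff (hG x)]
    refine ⟨fun k hk => ?_, fun y hy hym => ?_, fun y hy => ?_⟩
    · obtain ⟨y, hy, hyk⟩ := h₁ k hk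
      exact ⟨y, hy, ih hyk⟩
    · rcases h₃ y hy with hle | ⟨z, hz, hzm⟩
      · obtain ⟨k, hk⟩ := ENat.ne_top_iff_exists.mp (ne_top_of_le_ne_top (ENat.natCast_ne_top m) hle)
        have := ih hk.symm
        rw [hym] at this
        exact h₂ y hy (hk.symm.trans this.symm)
      · exact ((sgApprox_succ_eq_iff (hG y) n m).mp hym).2.1 z hz hzm
    · rcases h₃ y hy with hle | ⟨z, hz, hzm⟩
      · left
        obtain ⟨k, hk⟩ := ENat.ne_top_iff_exists.mp (ne_top_of_le_ne_top (ENat.natCast_ne_top m) hle)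
        rw [ih hk.symm, hk]
        exact hle
      · exact Or.inr ⟨z, hz, ih hzm⟩

theorem sgApprox_of_le (hG : LocallyFinite G) {n n' m : ℕ} {x : V} (hn : n ≤ n')
    (h : sgApprox G n x = m) : sgApprox G n' x = m := by
  induction n', hn using Nat.le_induction with
  | base => exact h
  | succ n' _ ih => exact sgApprox_succ_of_eq hG ih

theorem hasNimValue_iff_exists (hG : LocallyFinite G) {x : V} {m : ℕ} :
    HasNimValue G x m ↔ ∃ n, sgApprox G n x = m := by
  constructor
  · intro h
    exact h.exists
  · rintro ⟨n, h⟩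
    filter_upwards [eventually_ge_atTop n] with n' hn'
    exact sgApprox_of_le hG hn' h

theorem HasNimValue.unique {x : V} {m m' : ℕ} (h : HasNimValue G x m) (h' : HasNimValue G x m') :
    m = m' := by
  obtain ⟨n, hn, hn'⟩ := (h.and h').exists
  exact Nat.cast_injective (hn.symm.trans hn')

/-- Finite values persist once attained, so a vertex without a limit value never has a finite
approximation, and finitely many vertices settle simultaneously. -/
theorem exists_sgApprox_forall (hG : LocallyFinite G) {S : Set V} (hS : S.Finite) :
    ∀ᶠ n in atTop, ∀ y ∈ S, ∀ m : ℕ, sgApprox G n y = m ↔ HasNimValue G y m := by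
  rw [hS.eventually_all]
  intro y _
  by_cases h : ∃ k, HasNimValue G y k
  · obtain ⟨k, hk⟩ := h
    filter_upwards [hk] with n hn m
    rw [hn]
    constructor
    · intro hm
      rwa [← Nat.cast_injective hm]
    · intro hm
      rw [hk.unique hm]
  · refine Eventually.of_forall fun n m => ⟨fun hm => ?_, fun hm => absurd ⟨m, hm⟩ h⟩
    exact (hasNimValue_iff_exists hG).mpr ⟨n, hm⟩

/-- The criterion involves only options and options of options. By local finiteness these are
finitely many, so all of them have settled at one stage, where the recursion can be read off. -/
theorem hasNimValue_iff (hG : LocallyFinite G) {x : V} {m : ℕ} :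
    HasNimValue G x m ↔
      (∀ k < m, ∃ y, G.Adj x y ∧ HasNimValue G y k) ∧
      (∀ y, G.Adj x y → ¬ HasNimValue G y m) ∧
      ∀ y, G.Adj x y → (∃ k ≤ m, HasNimValue G y k) ∨ ∃ z, G.Adj y z ∧ HasNimValue G z m := by
  have hfin : ({y | G.Adj x y} ∪ ⋃ y ∈ {y | G.Adj x y}, {z | G.Adj y z}).Finite :=
    (hG x).union ((hG x).biUnion fun y _ => hG y)
  have hle : ∀ {y n}, (∀ k : ℕ, sgApprox G n y = k ↔ HasNimValue G y k) →
      (sgApprox G n y ≤ m ↔ ∃ k ≤ m, HasNimValue G y k) := by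
    intro y n h
    rw [ENat.le_natCast_iff]
    constructor
    · rintro ⟨k, hk, hkm⟩
      exact ⟨k, hkm, (h k).mp hk⟩
    · rintro ⟨k, hkm, hk⟩
      exact ⟨k, (h k).mpr hk, hkm⟩
  have key : ∀ᶠ n in atTop, (sgApprox G (n + 1) x = m ↔
      (∀ k < m, ∃ y, G.Adj x y ∧ HasNimValue G y k) ∧
      (∀ y, G.Adj x y → ¬ HasNimValue G y m) ∧
      ∀ y, G.Adj x y → (∃ k ≤ m, HasNimValue G y k) ∨ ∃ z, G.Adj y z ∧ HasNimValue G z m) := by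
    filter_upwards [exists_sgApprox_forall hG hfin] with n hn
    have h₁ : ∀ y, G.Adj x y → ∀ k : ℕ, sgApprox G n y = k ↔ HasNimValue G y k :=
      fun y hy => hn y (Or.inl hy)
    have h₂ : ∀ y, G.Adj x y → ∀ z, G.Adj y z →
        ∀ k : ℕ, sgApprox G n z = k ↔ HasNimValue G z k :=
      fun y hy z hz => hn z (Or.inr (Set.mem_biUnion (show y ∈ {y | G.Adj x y} from hy) hz))
    rw [sgApprox_succ_eq_iff (hG x)]
    refine and_congr (forall₂_congr fun k _ => exists_congr fun y => and_congr_right fun hy =>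
      h₁ y hy k) (and_congr (forall₂_congr fun y hy => not_congr (h₁ y hy m))
      (forall₂_congr fun y hy => or_congr (hle (h₁ y hy)) (exists_congr fun z =>
        and_congr_right fun hz => h₂ y hy z hz m)))
  constructor
  · intro h
    obtain ⟨n, hn, hn'⟩ := (key.and ((tendsto_add_atTop_nat 1).eventually h)).exists
    exact hn.mp hn'
  · intro h
    obtain ⟨n, hn⟩ := key.exists
    exact (hasNimValue_iff_exists hG).mpr ⟨n + 1, hn.mpr h⟩

/-- The set of finite values of the options of `x`. -/
def optionValues (G : Digraph V) (x : V) : Set ℕ := {a | ∃ y, G.Adj x y ∧ HasNimValue G y a}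

/-- The value of `x` is infinite. -/
def HasInfiniteRank (G : Digraph V) (x : V) : Prop := ∀ m, ¬ HasNimValue G x m

theorem sg_eq_infty_iff {x : V} {A : Set ℕ} :
    sg G x = .infty A ↔ HasInfiniteRank G x ∧ optionValues G x = A := by
  unfold sg
  split_ifs with h
  · simp only [false_iff, not_and]
    exact fun h' => absurd h (not_exists.mpr h')
  · rw [SGValue.infty.injEq]
    exact (and_iff_right (not_exists.mp h)).symm

/-- A position of infinite rank has an option of infinite rank that cannot be moved to `m`, where
`m` is the least value not attained by an option. -/
theorem HasInfiniteRank.exists_option (hG : LocallyFinite G) {x : V} (hx : HasInfiniteRank G x)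
    {m : ℕ} (hm : ∀ k < m, k ∈ optionValues G x) (hm' : m ∉ optionValues G x) :
    ∃ y, G.Adj x y ∧ HasInfiniteRank G y ∧ m ∉ optionValues G y := by
  by_contra! hcon
  refine hx m ((hasNimValue_iff hG).mpr ⟨hm, fun y hy hy' => hm' ⟨y, hy, hy'⟩, fun y hy => ?_⟩)
  by_cases hy' : HasInfiniteRank G y
  · exact Or.inr (hcon y hy hy')
  · obtain ⟨k, hk⟩ := not_forall_not.mp hy'
    rcases le_or_gt k m with hkm | hkm
    · exact Or.inl ⟨k, hkm, hk⟩
    -- A value above `m` is a mex, so `m` is among the values of the options.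
    · exact Or.inr (((hasNimValue_iff hG).mp hk).1 m hkm)

/-- Converse to `HasInfiniteRank.exists_option`; the only `m` to which `h` applies is the mex of
`optionValues G x`. -/
theorem hasInfiniteRank_of_option (hG : LocallyFinite G) {x y : V} (hy : G.Adj x y)
    (hrank : HasInfiniteRank G y)
    (h : ∀ m, (∀ k < m, k ∈ optionValues G x) → m ∉ optionValues G x → m ∉ optionValues G y) :
    HasInfiniteRank G x := by
  intro m hm
  obtain ⟨h₁, h₂, h₃⟩ := (hasNimValue_iff hG).mp hm
  rcases h₃ y hy with ⟨k, -, hk⟩ | hz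
  · exact hrank k hk
  · exact h m h₁ (fun ⟨z, hz, hz'⟩ => h₂ z hz hz') hz

theorem optionValues_finite (hG : LocallyFinite G) (x : V) :
    (optionValues G x).Finite := by
  -- The infimum is the value of `y` when there is one; options without a value only add a harmless
  -- `0`.
  refine (((hG x).image fun y => sInf {m | HasNimValue G y m})).subset ?_
  rintro a ⟨y, hy, hya⟩
  refine ⟨y, hy, ?_⟩
  have : {m | HasNimValue G y m} = {a} := by
    ext m
    exact ⟨fun hm => HasNimValue.unique hm hya, fun hm => by rw [Set.mem_singleton_iff.mp hm]; exact hya⟩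
  simp [this]

/-! #### Values along maps that identify options -/

/-- By hypothesis `φ` maps the options of `x` onto those of `φ x`, and the recursion sees only the
set of values of the options, so injectivity plays no role. -/
theorem sgApprox_map {φ : V → W}
    (hφ : ∀ x w, H.Adj (φ x) w ↔ ∃ y, G.Adj x y ∧ φ y = w) (n : ℕ) (x : V) :
    sgApprox H n (φ x) = sgApprox G n x := by
  induction n generalizing x with
  | zero =>
    have : IsTerminal H (φ x) ↔ IsTerminal G x := by
      simp only [IsTerminal, hφ]
      exact ⟨fun h y hy => h _ ⟨y, hy, rfl⟩, fun h w ⟨y, hy, _⟩ => h y hy⟩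
    by_cases h : IsTerminal G x
    · simp [sgApprox, h, this.mpr h]
    · simp [sgApprox, h, mt this.mp h]
  | succ n ih =>
    have hex : ∀ (x : V) (q : ℕ∞ → Prop), (∃ w, H.Adj (φ x) w ∧ q (sgApprox H n w)) ↔
        ∃ y, G.Adj x y ∧ q (sgApprox G n y) := by
      intro x q
      simp only [hφ]
      constructor
      · rintro ⟨_, ⟨y, hy, rfl⟩, hq⟩
        exact ⟨y, hy, by rwa [← ih]⟩
      · rintro ⟨y, hy, hq⟩
        exact ⟨φ y, ⟨y, hy, rfl⟩, by rwa [ih]⟩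
    simp only [sgApprox]
    have hset : {a | ∃ w, H.Adj (φ x) w ∧ sgApprox H n w = a} =
        {a | ∃ y, G.Adj x y ∧ sgApprox G n y = a} := by
      ext a
      exact hex x (· = a)
    rw [hset]
    have hall : ∀ m : ℕ, (∀ w, H.Adj (φ x) w → sgApprox H n w ≤ m ∨
          ∃ z, H.Adj w z ∧ sgApprox H n z = m) ↔
        ∀ y, G.Adj x y → sgApprox G n y ≤ m ∨ ∃ z, G.Adj y z ∧ sgApprox G n z = m := by
      intro m
      have : ∀ y, (sgApprox H n (φ y) ≤ m ∨ ∃ z, H.Adj (φ y) z ∧ sgApprox H n z = m) ↔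
          (sgApprox G n y ≤ m ∨ ∃ z, G.Adj y z ∧ sgApprox G n z = m) := fun y => by
        rw [ih, hex y (· = (m : ℕ∞))]
      constructor
      · exact fun h y hy => (this y).mp (h _ ((hφ x _).mpr ⟨y, hy, rfl⟩))
      · intro h w hw
        obtain ⟨y, hy, rfl⟩ := (hφ x w).mp hw
        exact (this y).mpr (h y hy)
    split_ifs with h₁ h₂ h₂
    · rfl
    · exact absurd ((hall _).mp h₁) h₂
    · exact absurd ((hall _).mpr h₂) h₁
    · rfl

theorem hasNimValue_map {φ : V → W}
    (hφ : ∀ x w, H.Adj (φ x) w ↔ ∃ y, G.Adj x y ∧ φ y = w) (x : V) (m : ℕ) :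
    HasNimValue H (φ x) m ↔ HasNimValue G x m := by
  simp only [HasNimValue, sgApprox_map hφ]

/-! #### Winning strategies -/

section Strategy

theorem history_getLast (w : ℕ → V) (i : ℕ) (x : V) : (history w i).getLastD x = w i := by
  simp [history, List.range_succ, List.getLastD_eq_getLast?]

/-- A positional strategy `f` wins for player `b` if from some set `S`, containing all positions
which that player may face, it reaches lower and lower positions of a set `T`. -/
theorem isWinning_positional {x : V} {b : ℕ} (hb : b < 2) (f : V → V) (r : V → ℕ) (S : Set V)
    (hlegal : ∀ y ∈ S, G.Adj y (f y))
    (hstep : ∀ y ∈ S, ∀ z, G.Adj (f y) z → z ∈ S ∧ r z < r y)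
    (hstart : (b = 0 ∧ x ∈ S) ∨ (b = 1 ∧ ∀ y, G.Adj x y → y ∈ S)) :
    IsWinning G x b (fun l => f (l.getLastD x)) := by
  -- The player's turns come at times `2 * n + b`; by then `r` has dropped by at least `n`, which
  -- bounds the length of the play.
  have key : ∀ (w : ℕ → V) (n : ℕ),
      IsPlayFollowing G x b (fun l => f (l.getLastD x)) w (2 * n + b) →
      w (2 * n + b) ∈ S ∧ r (w (2 * n + b)) + n ≤ r (w b) := by
    intro w n
    induction n with
    | zero =>
      rintro ⟨h0, hw⟩
      refine ⟨?_, by simp⟩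
      rcases hstart with ⟨rfl, h⟩ | ⟨rfl, h⟩
      · simpa [h0] using h
      · have := (hw 0 (by omega)).1
        rw [h0] at this
        simpa using h _ this
    | succ n ih =>
      rintro ⟨h0, hw⟩
      obtain ⟨h₁, h₂⟩ := ih ⟨h0, fun i hi => hw i (by omega)⟩
      have hmove := (hw (2 * n + b) (by omega)).2 (by omega)
      simp only [history_getLast] at hmove
      have hreply := (hw (2 * n + b + 1) (by omega)).1
      rw [hmove] at hreply
      obtain ⟨h₃, h₄⟩ := hstep _ h₁ _ hreply
      have he : 2 * (n + 1) + b = 2 * n + b + 1 + 1 := by ring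
      rw [he]
      exact ⟨h₃, by omega⟩
  constructor
  · intro w n hw hn
    simp only [history_getLast]
    obtain ⟨k, rfl⟩ : ∃ k, n = 2 * k + b := ⟨n / 2, by omega⟩
    exact hlegal _ (key w k hw).1
  · intro w hw
    have := (key w (r (w b) + 1) (hw _)).2
    omega

/-- The stage at which the value `0` appears drops strictly after a move and a suitable reply; it is
the rank that makes the winning strategy terminate. -/
theorem exists_lower_of_option_zero (hG : LocallyFinite G) {n : ℕ} {x y : V}
    (hx : sgApprox G n x = (0 : ℕ)) (hxy : G.Adj x y) :
    ∃ n' < n, ∃ z, G.Adj y z ∧ sgApprox G n' z = (0 : ℕ) := by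
  cases n with
  | zero => exact absurd hxy (((sgApprox_zero_eq_iff x 0).mp hx).1 y)
  | succ n =>
    obtain ⟨-, h₂, h₃⟩ := (sgApprox_succ_eq_iff (hG x) n 0).mp hx
    refine ⟨n, n.lt_succ_self, (h₃ y hxy).resolve_left fun h => h₂ y hxy ?_⟩
    simpa using h

theorem exists_positional (hG : LocallyFinite G) :
    ∃ (f : V → V) (r : V → ℕ),
      (∀ y, 0 ∈ optionValues G y → G.Adj y (f y) ∧ HasNimValue G (f y) 0) ∧
      ∀ y, 0 ∈ optionValues G y → ∀ z, G.Adj (f y) z → 0 ∈ optionValues G z ∧ r z < r y := by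
  classical
  have hex : ∀ y, 0 ∈ optionValues G y ↔ ∃ n z, G.Adj y z ∧ sgApprox G n z = (0 : ℕ) := by
    intro y
    simp only [optionValues, Set.mem_ofPred_eq, hasNimValue_iff_exists hG]
    exact ⟨fun ⟨z, hz, n, h⟩ => ⟨n, z, hz, h⟩, fun ⟨n, z, hz, h⟩ => ⟨z, hz, n, h⟩⟩
  -- The first stage at which some option shows the value `0`; the strategy moves to such an option.
  let r : V → ℕ := fun y => sInf {n | ∃ z, G.Adj y z ∧ sgApprox G n z = (0 : ℕ)}
  have hr : ∀ y, 0 ∈ optionValues G y → ∃ z, G.Adj y z ∧ sgApprox G (r y) z = (0 : ℕ) :=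
    fun y hy => Nat.sInf_mem (s := {n | ∃ z, G.Adj y z ∧ sgApprox G n z = (0 : ℕ)})
      ((hex y).mp hy)
  refine ⟨fun y => if h : 0 ∈ optionValues G y then (hr y h).choose else y, r, ?_, ?_⟩
  · intro y hy
    obtain ⟨h₁, h₂⟩ := (hr y hy).choose_spec
    simp only [dif_pos hy]
    exact ⟨h₁, (hasNimValue_iff_exists hG).mpr ⟨_, h₂⟩⟩
  · intro y hy z hz
    simp only [dif_pos hy] at hz
    obtain ⟨n', hn', z', hz', h'⟩ := exists_lower_of_option_zero hG (hr y hy).choose_spec.2 hz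
    exact ⟨(hex z).mpr ⟨n', z', hz', h'⟩, lt_of_le_of_lt (Nat.sInf_le ⟨z', hz', h'⟩) hn'⟩

theorem firstPlayerWins_of_zero_mem (hG : LocallyFinite G) {x : V} (hx : 0 ∈ optionValues G x) :
    FirstPlayerWins G x := by
  obtain ⟨f, r, h₁, h₂⟩ := exists_positional hG
  exact ⟨_, isWinning_positional two_pos f r {y | 0 ∈ optionValues G y} (fun y hy => (h₁ y hy).1) h₂
    (Or.inl ⟨rfl, hx⟩)⟩

theorem secondPlayerWins_of_hasNimValue_zero (hG : LocallyFinite G) {x : V}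
    (hx : HasNimValue G x 0) : SecondPlayerWins G x := by
  obtain ⟨f, r, h₁, h₂⟩ := exists_positional hG
  refine ⟨_, isWinning_positional one_lt_two f r {y | 0 ∈ optionValues G y}
    (fun y hy => (h₁ y hy).1) h₂ (Or.inr ⟨rfl, fun y hy => ?_⟩)⟩
  obtain ⟨-, hx₂, hx₃⟩ := (hasNimValue_iff hG).mp hx
  refine (hx₃ y hy).resolve_left ?_
  rintro ⟨k, hk, hyk⟩
  rw [Nat.le_zero.mp hk] at hyk
  exact hx₂ y hy hyk

/-- Value `0` is a win for the second player, and a positive value leaves a move to value `0`, a win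
for the first. -/
theorem IsDraw.hasInfiniteRank (hG : LocallyFinite G) {x : V} (hx : IsDraw G x) :
    HasInfiniteRank G x ∧ 0 ∉ optionValues G x := by
  refine ⟨fun m hm => ?_, fun h => hx.1 (firstPlayerWins_of_zero_mem hG h)⟩
  rcases Nat.eq_zero_or_pos m with rfl | hpos
  · exact hx.2 (secondPlayerWins_of_hasNimValue_zero hG hm)
  · exact hx.1 (firstPlayerWins_of_zero_mem hG (((hasNimValue_iff hG).mp hm).1 0 hpos))

end Strategy

end LoopyGame

namespace GaltonWatson

/-! ### Subtrees, and the value of the root in terms of its children -/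

open LoopyGame

/-- The family sizes in the subtree of the descendants of `u`. -/
def subtree (u : List ℕ) (c : List ℕ → ℕ) : List ℕ → ℕ := fun v => c (u ++ v)

theorem subtree_subtree (u v : List ℕ) (c : List ℕ → ℕ) :
    subtree v (subtree u c) = subtree (u ++ v) c := by
  funext w
  simp [subtree]

theorem subtree_nil (c : List ℕ → ℕ) : subtree [] c = c := rfl

theorem append_singleton_mem_vertices {c : List ℕ → ℕ} {u : List ℕ} {i : ℕ} :
    u ++ [i] ∈ vertices c ↔ u ∈ vertices c ∧ i < c u := by
  constructor
  · intro h
    exact ⟨fun v j hv => h v j (hv.trans (List.prefix_append u [i])), h u i List.prefix_rfl⟩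
  · rintro ⟨h, hi⟩ v j hv
    rcases List.prefix_concat_iff.mp hv with heq | hpre
    · obtain ⟨rfl, h'⟩ := List.append_inj' heq rfl
      rw [List.cons.inj h' |>.1]
      exact hi
    · exact h v j hpre

theorem append_mem_vertices {c : List ℕ → ℕ} {u : List ℕ} (hu : u ∈ vertices c) (v : List ℕ) :
    u ++ v ∈ vertices c ↔ v ∈ vertices (subtree u c) := by
  induction v using List.reverseRecOn with
  | nil => exact iff_of_true (by rwa [List.append_nil]) (root (subtree u c)).2
  | append_singleton v i ih =>
    rw [← List.append_assoc, append_singleton_mem_vertices, append_singleton_mem_vertices, ih]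
    rfl

/-- The vertices of the subtree of the descendants of `u`, as vertices of the whole tree. -/
def subtreeMap (c : List ℕ → ℕ) (u : vertices c) (v : vertices (subtree u c)) : vertices c :=
  ⟨u ++ v, (append_mem_vertices u.2 v).mpr v.2⟩

theorem adj_subtreeMap (c : List ℕ → ℕ) (u : vertices c) (x : vertices (subtree u c))
    (w : vertices c) : (tree c).Adj (subtreeMap c u x) w ↔
      ∃ y, (tree (subtree u c)).Adj x y ∧ subtreeMap c u y = w := by
  constructor
  · rintro ⟨i, hi⟩
    have hi' : (w : List ℕ) = u ++ (x ++ [i]) := by rw [hi, ← List.append_assoc]; rfl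
    exact ⟨⟨x ++ [i], (append_mem_vertices u.2 _).mp (hi' ▸ w.2)⟩, ⟨i, rfl⟩, Subtype.ext hi'.symm⟩
  · rintro ⟨y, ⟨i, hi⟩, rfl⟩
    exact ⟨i, by simp [subtreeMap, hi]⟩

theorem subtreeMap_root (c : List ℕ → ℕ) (u : vertices c) : subtreeMap c u (root _) = u :=
  Subtype.ext (List.append_nil _)

/-- The approximations of the Sprague-Grundy function at the root. -/
noncomputable def rootApprox (n : ℕ) (c : List ℕ → ℕ) : ℕ∞ := sgApprox (tree c) n (root c)

/-- The root has the finite value `m`. -/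
def RootNimValue (c : List ℕ → ℕ) (m : ℕ) : Prop := HasNimValue (tree c) (root c) m

/-- The root has infinite rank. -/
def RootInfinite (c : List ℕ → ℕ) : Prop := HasInfiniteRank (tree c) (root c)

/-- The finite values of the children of the root. -/
def rootOptionValues (c : List ℕ → ℕ) : Set ℕ := optionValues (tree c) (root c)

theorem sgApprox_tree (c : List ℕ → ℕ) (u : vertices c) (n : ℕ) :
    sgApprox (tree c) n u = rootApprox n (subtree u c) := by
  rw [rootApprox, ← sgApprox_map (adj_subtreeMap c u), subtreeMap_root]

theorem hasNimValue_tree (c : List ℕ → ℕ) (u : vertices c) (m : ℕ) :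
    HasNimValue (tree c) u m ↔ RootNimValue (subtree u c) m := by
  rw [RootNimValue, ← hasNimValue_map (adj_subtreeMap c u), subtreeMap_root]

theorem hasInfiniteRank_tree (c : List ℕ → ℕ) (u : vertices c) :
    HasInfiniteRank (tree c) u ↔ RootInfinite (subtree u c) :=
  forall_congr' fun m => not_congr (hasNimValue_tree c u m)

theorem exists_adj_iff (c : List ℕ → ℕ) (u : vertices c) (q : (List ℕ → ℕ) → Prop) :
    (∃ y : vertices c, (tree c).Adj u y ∧ q (subtree y c)) ↔
      ∃ i < c u, q (subtree [i] (subtree u c)) := by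
  constructor
  · rintro ⟨⟨_, hy⟩, ⟨i, rfl⟩, hq⟩
    exact ⟨i, (append_singleton_mem_vertices.mp hy).2, by rwa [subtree_subtree]⟩
  · rintro ⟨i, hi, hq⟩
    exact ⟨⟨u ++ [i], append_singleton_mem_vertices.mpr ⟨u.2, hi⟩⟩, ⟨i, rfl⟩,
      by rwa [subtree_subtree] at hq⟩

theorem forall_adj_iff (c : List ℕ → ℕ) (u : vertices c) (q : (List ℕ → ℕ) → Prop) :
    (∀ y : vertices c, (tree c).Adj u y → q (subtree y c)) ↔
      ∀ i < c u, q (subtree [i] (subtree u c)) := by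
  have := exists_adj_iff c u fun c' => ¬ q c'
  rw [← not_iff_not]
  push Not
  exact this

theorem optionValues_tree (c : List ℕ → ℕ) (u : vertices c) :
    optionValues (tree c) u = rootOptionValues (subtree u c) := by
  ext a
  simp only [rootOptionValues, optionValues, Set.mem_ofPred_eq, hasNimValue_tree]
  rw [exists_adj_iff c u fun c' => RootNimValue c' a,
    exists_adj_iff _ (root (subtree u c)) fun c' => RootNimValue c' a]
  simp [root, subtree, subtree_nil]

theorem mem_rootOptionValues {c : List ℕ → ℕ} {a : ℕ} :
    a ∈ rootOptionValues c ↔ ∃ i < c [], RootNimValue (subtree [i] c) a := by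
  simp only [rootOptionValues, optionValues, Set.mem_ofPred_eq, hasNimValue_tree]
  exact exists_adj_iff c (root c) fun c' => RootNimValue c' a

theorem locallyFinite_tree (c : List ℕ → ℕ) : LocallyFinite (tree c) := by
  intro u
  refine Set.Finite.of_finite_image (f := Subtype.val) ?_ Subtype.val_injective.injOn
  refine ((Set.finite_Iio (c u)).image fun i => (u : List ℕ) ++ [i]).subset ?_
  rintro _ ⟨⟨_, hy⟩, ⟨i, rfl⟩, rfl⟩
  exact ⟨i, (append_singleton_mem_vertices.mp hy).2, rfl⟩

theorem rootApprox_succ_eq_iff (n m : ℕ) (c : List ℕ → ℕ) :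
    rootApprox (n + 1) c = m ↔
      (∀ k < m, ∃ i < c [], rootApprox n (subtree [i] c) = k) ∧
      (∀ i < c [], rootApprox n (subtree [i] c) ≠ m) ∧
      ∀ i < c [], rootApprox n (subtree [i] c) ≤ m ∨
        ∃ j < c [i], rootApprox n (subtree [i, j] c) = m := by
  rw [rootApprox, sgApprox_succ_eq_iff (locallyFinite_tree c _)]
  simp only [sgApprox_tree]
  refine and_congr (forall₂_congr fun k _ =>
    exists_adj_iff c (root c) fun c' => rootApprox n c' = k)
    (and_congr (forall_adj_iff c (root c) fun c' => rootApprox n c' ≠ m) ?_)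
  have h : ∀ y : vertices c, (∃ z, (tree c).Adj y z ∧ rootApprox n (subtree z c) = m) ↔
      ∃ j < subtree y c [], rootApprox n (subtree [j] (subtree y c)) = m := fun y => by
    rw [exists_adj_iff c y fun c' => rootApprox n c' = m]
    simp [subtree]
  simp only [h]
  exact forall_adj_iff c (root c) fun c' => rootApprox n c' ≤ m ∨
    ∃ j < c' [], rootApprox n (subtree [j] c') = m

theorem RootNimValue.unique {c : List ℕ → ℕ} {m m' : ℕ} (h : RootNimValue c m)
    (h' : RootNimValue c m') : m = m' :=
  HasNimValue.unique h h'

theorem RootNimValue.lt_mem {c : List ℕ → ℕ} {m k : ℕ} (h : RootNimValue c m) (hk : k < m) :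
    k ∈ rootOptionValues c :=
  ((hasNimValue_iff (locallyFinite_tree c)).mp h).1 k hk

/-- Distinct values need distinct children, and children outside `T` carry none. -/
theorem ncard_rootOptionValues_le {c : List ℕ → ℕ} {S : Set ℕ} (hS : S ⊆ rootOptionValues c)
    {T : Set ℕ} (hT : ∀ i < c [], i ∉ T → RootInfinite (subtree [i] c)) (hTfin : T.Finite) :
    S.ncard ≤ T.ncard := by
  have hex : ∀ a ∈ S, ∃ i ∈ T, RootNimValue (subtree [i] c) a := by
    intro a ha
    obtain ⟨i, hi, hia⟩ := mem_rootOptionValues.mp (hS ha)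
    by_contra! h
    exact hT i hi (fun hiT => h i hiT hia) a hia
  choose! f hf using hex
  refine Set.ncard_le_ncard_of_injOn f (fun a ha => (hf a ha).1) (fun a ha b hb hab => ?_) hTfin
  exact (hf a ha).2.unique (hab ▸ (hf b hb).2)

theorem RootNimValue.le_degree {c : List ℕ → ℕ} {m : ℕ} (h : RootNimValue c m) : m ≤ c [] := by
  have := ncard_rootOptionValues_le (S := Set.Iio m) (T := Set.Iio (c [])) (c := c)
    (fun k hk => h.lt_mem hk) (fun i hi hi' => absurd hi hi') (Set.finite_Iio _)
  simpa using this

/-- One child has infinite rank and so contributes no value. -/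
theorem RootInfinite.ncard_lt_degree {c : List ℕ → ℕ} (h : RootInfinite c) :
    (rootOptionValues c).ncard + 1 ≤ c [] := by
  obtain ⟨m, hm, hm'⟩ : ∃ m, (∀ k < m, k ∈ rootOptionValues c) ∧ m ∉ rootOptionValues c := by
    have hfin : (rootOptionValues c).Finite := optionValues_finite (locallyFinite_tree c) _
    obtain ⟨b, hb⟩ := hfin.infinite_compl.nonempty
    classical
    exact ⟨Nat.find ⟨b, hb⟩, fun k hk => not_not.mp (Nat.find_min ⟨b, hb⟩ hk),
      Nat.find_spec (p := fun b => b ∉ rootOptionValues c) ⟨b, hb⟩⟩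
  obtain ⟨y, hy, hy', -⟩ := HasInfiniteRank.exists_option (locallyFinite_tree c) h hm hm'
  obtain ⟨i, hi, hi'⟩ := (exists_adj_iff c (root c) RootInfinite).mp
    ⟨y, hy, (hasInfiniteRank_tree c y).mp hy'⟩
  change i < c [] at hi
  have := ncard_rootOptionValues_le (c := c) (T := Set.Iio (c []) \ {i}) subset_rfl
    (fun j hj hj' => by
      by_cases hji : j = i
      · rw [hji]
        exact hi'
      · exact absurd ⟨hj, hji⟩ hj') ((Set.finite_Iio _).sdiff)
  rw [Set.ncard_sdiff_singleton_of_mem (show i ∈ Set.Iio (c []) from hi)] at this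
  have hc : (Set.Iio (c [])).ncard = c [] := by simp
  omega

/-- As all children have values below `m`, the reverting clause of `hasNimValue_iff` is never
needed. -/
theorem rootNimValue_of_children {c : List ℕ → ℕ} {m : ℕ} {f : ℕ → ℕ}
    (h : ∀ i < c [], RootNimValue (subtree [i] c) (f i)) (hf : ∀ i < c [], f i < m)
    (hf' : ∀ k < m, ∃ i < c [], f i = k) : RootNimValue c m := by
  rw [RootNimValue, hasNimValue_iff (locallyFinite_tree c)]
  simp only [hasNimValue_tree]
  refine ⟨fun k hk => ?_, ?_, fun y hy => Or.inl ?_⟩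
  · obtain ⟨i, hi, hik⟩ := hf' k hk
    exact (exists_adj_iff c (root c) fun c' => RootNimValue c' k).mpr ⟨i, hi, hik ▸ h i hi⟩
  · exact (forall_adj_iff c (root c) fun c' => ¬ RootNimValue c' m).mpr fun i hi hi' =>
      (hf i hi).ne ((h i hi).unique hi')
  · exact (forall_adj_iff c (root c) fun c' => ∃ k ≤ m, RootNimValue c' k).mpr
      (fun i hi => ⟨f i, (hf i hi).le, h i hi⟩) y hy

theorem rootInfinite_of_child {c : List ℕ → ℕ} {i m : ℕ} (hi : i < c [])
    (hinf : RootInfinite (subtree [i] c)) (hm : ∀ k < m, k ∈ rootOptionValues c)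
    (hm' : m ∉ rootOptionValues c) (hmi : m ∉ rootOptionValues (subtree [i] c)) :
    RootInfinite c := by
  obtain ⟨y, hy, hy₁, hy₂⟩ := (exists_adj_iff c (root c)
    fun c' => RootInfinite c' ∧ m ∉ rootOptionValues c').mpr ⟨i, hi, hinf, hmi⟩
  refine hasInfiniteRank_of_option (locallyFinite_tree c) hy ((hasInfiniteRank_tree c y).mpr hy₁) ?_
  intro m' h₁ h₂
  rw [optionValues_tree]
  rcases lt_trichotomy m m' with h | rfl | h
  · exact absurd (h₁ m h) hm'
  · exact hy₂
  · exact absurd (hm m' h) h₂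

/-! #### Measurability -/

theorem measurable_subtree (u : List ℕ) : Measurable (subtree u) :=
  measurable_pi_lambda _ fun v => measurable_pi_apply (u ++ v)

theorem measurable_lt_degree (i : ℕ) (u : List ℕ) :
    Measurable fun c : List ℕ → ℕ => i < c u :=
  (measurable_of_countable (fun n : ℕ => i < n)).comp (measurable_pi_apply u)

theorem measurable_rootApprox_eq (n m : ℕ) : Measurable fun c => rootApprox n c = m := by
  induction n generalizing m with
  | zero =>
    have : (fun c => rootApprox 0 c = m) = fun c : List ℕ → ℕ => ¬ 0 < c [] ∧ m = 0 := by
      funext c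
      rw [rootApprox, sgApprox_zero_eq_iff]
      have := forall_adj_iff c (root c) fun _ => False
      refine propext (and_congr_left fun _ => this.trans ?_)
      change (∀ i < c [], False) ↔ _
      exact ⟨fun h h' => h 0 h', fun h i hi => h (by omega)⟩
    rw [this]
    exact (measurable_lt_degree 0 []).not.and measurable_const
  | succ n ih =>
    have hsub : ∀ (u : List ℕ) (k : ℕ), Measurable fun c => rootApprox n (subtree u c) = k :=
      fun u k => (ih k).comp (measurable_subtree u)
    have hle : ∀ u : List ℕ, Measurable fun c => rootApprox n (subtree u c) ≤ m := by
      intro u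
      simp only [ENat.le_natCast_iff]
      exact Measurable.exists fun k => (hsub u k).and measurable_const
    simp only [rootApprox_succ_eq_iff]
    refine ((Measurable.forall fun k => measurable_const.imp <| Measurable.exists fun i =>
      (measurable_lt_degree i []).and (hsub _ _)).and ((Measurable.forall fun i =>
      (measurable_lt_degree i []).imp (hsub _ _).not).and (Measurable.forall fun i =>
      (measurable_lt_degree i []).imp ((hle _).or (Measurable.exists fun j =>
      (measurable_lt_degree j [i]).and (hsub _ _))))))

theorem measurable_rootNimValue (m : ℕ) : Measurable fun c => RootNimValue c m := by
  simp only [RootNimValue, hasNimValue_iff_exists (locallyFinite_tree _)]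
  exact Measurable.exists fun n => measurable_rootApprox_eq n m

theorem measurable_rootInfinite : Measurable RootInfinite :=
  Measurable.forall fun m => (measurable_rootNimValue m).not

theorem measurable_mem_rootOptionValues (a : ℕ) :
    Measurable fun c => a ∈ rootOptionValues c := by
  simp only [mem_rootOptionValues]
  exact Measurable.exists fun i => (measurable_lt_degree i []).and
    ((measurable_rootNimValue a).comp (measurable_subtree [i]))

/-- The trees whose root has the value `m`. -/
def nimEvent (m : ℕ) : Set (List ℕ → ℕ) := {c | RootNimValue c m}

/-- The trees whose root has the value `∞(A)`. -/
def inftyEvent (A : Set ℕ) : Set (List ℕ → ℕ) := {c | RootInfinite c ∧ rootOptionValues c = A}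

theorem mem_inftyEvent {c : List ℕ → ℕ} {A : Set ℕ} :
    c ∈ inftyEvent A ↔ sg (tree c) (root c) = .infty A :=
  sg_eq_infty_iff.symm

theorem sg_tree_eq_infty_iff {c : List ℕ → ℕ} {u : vertices c} {A : Set ℕ} :
    sg (tree c) u = .infty A ↔ subtree u c ∈ inftyEvent A := by
  rw [sg_eq_infty_iff, hasInfiniteRank_tree, optionValues_tree]
  rfl

theorem measurableSet_nimEvent (m : ℕ) : MeasurableSet (nimEvent m) :=
  measurableSet_setOfPred.mpr (measurable_rootNimValue m)

theorem measurableSet_inftyEvent (A : Set ℕ) : MeasurableSet (inftyEvent A) := by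
  refine measurableSet_setOfPred.mpr (measurable_rootInfinite.and ?_)
  simp only [Set.ext_iff]
  exact Measurable.forall fun a => (measurable_mem_rootOptionValues a).iff measurable_const

end GaltonWatson

namespace GaltonWatson

/-! ### The offspring law and its branching property -/

open LoopyGame

variable {p : PMF ℕ}

/-- The joint law of the family sizes of all potential individuals. -/
noncomputable def offspringLaw (p : PMF ℕ) : Measure (List ℕ → ℕ) :=
  Measure.infinitePi fun _ => p.toMeasure

instance (p : PMF ℕ) : IsProbabilityMeasure (offspringLaw p) :=
  inferInstanceAs (IsProbabilityMeasure (Measure.infinitePi _))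

theorem map_subtree_offspringLaw (p : PMF ℕ) (u : List ℕ) :
    (offspringLaw p).map (subtree u) = offspringLaw p :=
  Measure.map_infinitePi_infinitePi_of_inj (P := fun _ : List ℕ => p.toMeasure)
    (List.append_right_injective u)

theorem offspringLaw_preimage_subtree (p : PMF ℕ) (u : List ℕ) {S : Set (List ℕ → ℕ)}
    (hS : MeasurableSet S) : offspringLaw p (subtree u ⁻¹' S) = offspringLaw p S := by
  rw [← Measure.map_apply (measurable_subtree u) hS, map_subtree_offspringLaw]

theorem map_eval_offspringLaw (p : PMF ℕ) (u : List ℕ) :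
    (offspringLaw p).map (fun c => c u) = p.toMeasure :=
  (measurePreserving_eval_infinitePi (fun _ : List ℕ => p.toMeasure) u).map_eq

/-- The information contained in the family size of `v`. -/
abbrev familySigma (v : List ℕ) : MeasurableSpace (List ℕ → ℕ) :=
  MeasurableSpace.comap (fun c => c v) inferInstance

theorem measurable_familySigma {T : Set (List ℕ)} {v : List ℕ} (hv : v ∈ T) :
    Measurable[⨆ w ∈ T, familySigma w] fun c : List ℕ → ℕ => c v :=
  Measurable.mono (comap_measurable _) (le_iSup₂_of_le v hv le_rfl) le_rfl

theorem measurable_subtree_familySigma {T : Set (List ℕ)} {u : List ℕ} (hu : ∀ v, u ++ v ∈ T) :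
    Measurable[⨆ w ∈ T, familySigma w] (subtree u) :=
  @measurable_pi_lambda _ _ _ (_) _ _ fun v => measurable_familySigma (hu v)

theorem indep_familySigma (p : PMF ℕ) {S T : Set (List ℕ)} (h : Disjoint S T) :
    Indep (⨆ w ∈ S, familySigma w) (⨆ w ∈ T, familySigma w) (offspringLaw p) :=
  indep_iSup_of_disjoint (fun v => (measurable_pi_apply v).comap_le)
    (iIndepFun_infinitePi (P := fun _ : List ℕ => p.toMeasure) (X := fun _ n => n)
      fun _ => measurable_id).iIndep h

/-- The root degree and the subtrees of distinct children depend on disjoint sets of coordinates;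
the induction splits off one subtree at a time. -/
theorem offspringLaw_branching (p : PMF ℕ) (n : ℕ) {S : ℕ → Set (List ℕ → ℕ)}
    (hS : ∀ i, MeasurableSet (S i)) (j : ℕ) :
    offspringLaw p {c | c [] = n ∧ ∀ i < j, subtree [i] c ∈ S i} =
      p n * ∏ i ∈ Finset.range j, offspringLaw p (S i) := by
  induction j with
  | zero =>
    have : {c : List ℕ → ℕ | c [] = n ∧ ∀ i < 0, subtree [i] c ∈ S i} =
        (fun c => c []) ⁻¹' {n} := by
      ext c
      simp
    rw [this, ← Measure.map_apply (measurable_pi_apply []) (measurableSet_singleton n),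
      map_eval_offspringLaw, PMF.toMeasure_apply_singleton _ _ (measurableSet_singleton n)]
    simp
  | succ j ih =>
    -- All labels not below `[j]`: the root and the labels below `[i]` for `i < j` are among them.
    let T : Set (List ℕ) := {v | ∀ w, v ≠ [j] ++ w}
    have hind := indep_familySigma p (disjoint_compl_right (a := T))
    have hset : {c : List ℕ → ℕ | c [] = n ∧ ∀ i < j + 1, subtree [i] c ∈ S i} =
        {c | c [] = n ∧ ∀ i < j, subtree [i] c ∈ S i} ∩ subtree [j] ⁻¹' S j := by
      ext c
      constructor
      · rintro ⟨h, h'⟩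
        exact ⟨⟨h, fun i hi => h' i (by omega)⟩, h' j (by omega)⟩
      · rintro ⟨⟨h, h'⟩, h''⟩
        refine ⟨h, fun i hi => ?_⟩
        rcases Nat.lt_succ_iff_lt_or_eq.mp hi with hi | rfl
        · exact h' i hi
        · exact h''
    have h₁ : MeasurableSet[⨆ w ∈ T, familySigma w]
        {c : List ℕ → ℕ | c [] = n ∧ ∀ i < j, subtree [i] c ∈ S i} := by
      have h : {c : List ℕ → ℕ | c [] = n ∧ ∀ i < j, subtree [i] c ∈ S i} =
          (fun c => c []) ⁻¹' {n} ∩ ⋂ i ∈ Set.Iio j, subtree [i] ⁻¹' S i := by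
        ext c
        simp
      rw [h]
      refine MeasurableSet.inter (measurable_familySigma (by simp [T]) (measurableSet_singleton n))
        (MeasurableSet.biInter (Set.to_countable _) fun i hi =>
          measurable_subtree_familySigma (u := [i]) (T := T) (fun v w => ?_) (hS i))
      simpa using fun hij => absurd hij (ne_of_lt hi)
    have h₂ : MeasurableSet[⨆ w ∈ Tᶜ, familySigma w] (subtree [j] ⁻¹' S j) :=
      measurable_subtree_familySigma (u := [j]) (T := Tᶜ) (fun v h => h v rfl) (hS j)
    rw [hset, (Indep_iff _ _ _).mp hind _ _ h₁ h₂, ih, offspringLaw_preimage_subtree p _ (hS j),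
      Finset.prod_range_succ, mul_assoc]

theorem offspringLaw_pos_of_branching {n : ℕ} (hn : 0 < p n) {S : ℕ → Set (List ℕ → ℕ)}
    (hS : ∀ i, MeasurableSet (S i)) (hpos : ∀ i < n, 0 < offspringLaw p (S i))
    {E : Set (List ℕ → ℕ)} (hE : ∀ c, c [] = n → (∀ i < n, subtree [i] c ∈ S i) → c ∈ E) :
    0 < offspringLaw p E := by
  refine lt_of_lt_of_le ?_ (measure_mono (fun c hc => hE c hc.1 hc.2 :
    {c | c [] = n ∧ ∀ i < n, subtree [i] c ∈ S i} ⊆ E))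
  rw [offspringLaw_branching p n hS, pos_iff_ne_zero]
  exact mul_ne_zero hn.ne' (Finset.prod_ne_zero_iff.mpr fun i hi =>
    (hpos i (Finset.mem_range.mp hi)).ne')

/-! ### Values that occur with positive probability -/

theorem nimEvent_pos (hp : 0 < p 0) {m : ℕ} (hm : ∃ n ≥ m, 0 < p n) :
    0 < offspringLaw p (nimEvent m) := by
  induction m using Nat.strong_induction_on with
  | _ m ih =>
    obtain ⟨n, hmn, hn⟩ := hm
    have ih' : ∀ k < m, 0 < offspringLaw p (nimEvent k) :=
      fun k hk => ih k hk ⟨n, by omega, hn⟩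
    rcases Nat.eq_zero_or_pos m with rfl | hpos
    · refine offspringLaw_pos_of_branching (S := fun _ => ∅) hp (fun i => .empty) (by simp) ?_
      intro c hc _
      exact rootNimValue_of_children (f := id) (by simp [hc]) (by simp [hc]) (by simp)
    -- The first `m` children realise `0, …, m - 1`; surplus children get the value `0`, which is
    -- below `m` and changes nothing.
    · let f : ℕ → ℕ := fun i => if i < m then i else 0
      have hf : ∀ i, f i < m := fun i => by
        simp only [f]
        split_ifs <;> assumption
      refine offspringLaw_pos_of_branching (S := fun i => nimEvent (f i)) hn
        (fun i => measurableSet_nimEvent _) (fun i _ => ih' _ (hf i)) ?_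
      intro c hc hS
      exact rootNimValue_of_children (f := f) (by rwa [hc]) (fun i _ => hf i)
        fun k hk => ⟨k, by omega, if_pos hk⟩

theorem exists_enumeration (F : Finset ℕ) :
    ∃ e : ℕ → ℕ, (∀ i < F.card, e i ∈ F) ∧ ∀ a ∈ F, ∃ i < F.card, e i = a := by
  refine ⟨fun i => if h : i < F.card then F.equivFin.symm ⟨i, h⟩ else 0, fun i hi => ?_,
    fun a ha => ⟨F.equivFin ⟨a, ha⟩, (F.equivFin ⟨a, ha⟩).2, ?_⟩⟩
  · simp [hi]
  · simp

/-- The first `F.card` children carry the values in `F`, and the others, at least one, have value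
`∞(B)`. Since `m` is the mex of `F` and `m ∉ B`, such a child forces infinite rank. -/
theorem inftyEvent_pos_of_option {n m : ℕ} (hn : 0 < p n) {F : Finset ℕ} (hF : F.card < n)
    (hnim : ∀ a ∈ F, 0 < offspringLaw p (nimEvent a)) {B : Set ℕ}
    (hB : 0 < offspringLaw p (inftyEvent B)) (hm : ∀ k < m, k ∈ F) (hmF : m ∉ F) (hmB : m ∉ B) :
    0 < offspringLaw p (inftyEvent F) := by
  obtain ⟨e, he, he'⟩ := exists_enumeration F
  refine offspringLaw_pos_of_branching hn
    (S := fun i => if i < F.card then nimEvent (e i) else inftyEvent B) (fun i => ?_)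
    (fun i _ => ?_) ?_
  · split_ifs
    exacts [measurableSet_nimEvent _, measurableSet_inftyEvent _]
  · split_ifs with hi
    exacts [hnim _ (he i hi), hB]
  · intro c hc hS
    have hnimS : ∀ i < F.card, RootNimValue (subtree [i] c) (e i) := fun i hi => by
      have := hS i (hi.trans hF)
      rwa [if_pos hi] at this
    have hinfS : ∀ i < n, ¬ i < F.card → subtree [i] c ∈ inftyEvent B := fun i hi hi' => by
      have := hS i hi
      rwa [if_neg hi'] at this
    have hvals : rootOptionValues c = F := by
      ext a
      rw [mem_rootOptionValues, hc]
      constructor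
      · rintro ⟨i, hi, hia⟩
        by_cases hi' : i < F.card
        · rw [hia.unique (hnimS i hi')]
          exact he i hi'
        · exact absurd hia ((hinfS i hi hi').1 a)
      · intro ha
        obtain ⟨i, hi, rfl⟩ := he' a ha
        exact ⟨i, hi.trans hF, hnimS i hi⟩
    obtain ⟨h₁, h₂⟩ := hinfS F.card hF (lt_irrefl _)
    refine ⟨rootInfinite_of_child (m := m) (hc ▸ hF) h₁ ?_ ?_ ?_, hvals⟩
    · rwa [hvals]
    · rwa [hvals]
    · rwa [h₂]

/-- Suppose that almost surely a root of infinite rank can be moved to all values less than `k`,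
and that with positive probability one cannot be moved to `k`. Then all sets `F` that contain the
values less than `k`, and that fit into some family, occur. -/
theorem inftyEvent_pos {k : ℕ} (hp : 0 < p 0)
    (hst : ∀ᵐ c ∂(offspringLaw p), RootInfinite c → Set.Iio k ⊆ rootOptionValues c)
    (hnst : 0 < offspringLaw p {c | RootInfinite c ∧ ¬ Set.Iic k ⊆ rootOptionValues c})
    {F : Finset ℕ} (hkF : Set.Iio k ⊆ (F : Set ℕ)) {n : ℕ} (hn : 0 < p n) (hF : F.card < n)
    (hdeg : ∀ a ∈ F, ∃ n ≥ a, 0 < p n) : 0 < offspringLaw p (inftyEvent F) := by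
  have hnim : ∀ a ∈ F, 0 < offspringLaw p (nimEvent a) := fun a ha => nimEvent_pos hp (hdeg a ha)
  -- There are only countably many finite sets `B`, so one of them has positive probability. By
  -- `hst`, the element of `{0, …, k}` that is missing must be `k`.
  obtain ⟨B, hkB, hB⟩ : ∃ B : Finset ℕ, k ∉ B ∧ 0 < offspringLaw p (inftyEvent B) := by
    by_contra! hcon
    refine hnst.ne' (measure_mono_null_ae ?_ (measure_iUnion_null
      (s := fun B : {B : Finset ℕ // k ∉ B} => inftyEvent (B : Finset ℕ))
      fun B => le_zero_iff.mp (hcon B B.2)))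
    filter_upwards [hst] with c hc
    rintro ⟨h₁, h₂⟩
    have hfin : (rootOptionValues c).Finite := optionValues_finite (locallyFinite_tree c) _
    refine Set.mem_iUnion.mpr ⟨⟨hfin.toFinset, ?_⟩, h₁, hfin.coe_toFinset.symm⟩
    rw [hfin.mem_toFinset]
    intro hk
    refine h₂ fun a ha => ?_
    rcases lt_or_eq_of_le (Set.mem_Iic.mp ha) with h | rfl
    exacts [hc h₁ h, hk]
  have hrange : Finset.range k ⊆ F := fun a ha => hkF (Finset.mem_range.mp ha)
  -- The mex of `F` might lie in `B`, so `B` is first replaced by `{0, …, k - 1}`, which contains no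
  -- number outside `F`.
  have hk : 0 < offspringLaw p (inftyEvent (Finset.range k : Finset ℕ)) :=
    inftyEvent_pos_of_option hn ((Finset.card_le_card hrange).trans_lt hF)
      (fun a ha => hnim a (hrange ha)) hB (m := k) (by simp) (by simp) hkB
  have hex : ∃ m, m ∉ F := Infinite.exists_notMem_finset F
  classical
  exact inftyEvent_pos_of_option hn hF hnim hk (m := Nat.find hex)
    (fun j hj => not_not.mp (Nat.find_min hex hj)) (Nat.find_spec hex)
    (fun h => Nat.find_spec hex (hrange h))

theorem ae_degree_le {d : ℕ} (hd : HasMaxOutDegree p d) :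
    ∀ᵐ c ∂(offspringLaw p), ∀ v, c v ≤ d := by
  rw [ae_all_iff]
  intro v
  have h : ∀ᵐ n ∂p.toMeasure, n ≤ d := by
    rw [ae_iff, PMF.toMeasure_apply_eq_zero_iff _ (MeasurableSet.of_discrete)]
    rw [Set.disjoint_left]
    intro n hn hn'
    exact hn' (hd.1 (pos_iff_ne_zero.mpr ((p.mem_support_iff n).mp hn)))
  rw [← map_eval_offspringLaw p v] at h
  exact ae_of_ae_map (measurable_pi_apply v).aemeasurable h

/-- A nonempty bounded set of naturals attains its supremum; `p 0 > 0` makes it nonempty. -/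
theorem HasMaxOutDegree.pos (hp : 0 < p 0) {d : ℕ} (hd : HasMaxOutDegree p d) : 0 < p d := by
  have h := Nat.sSup_mem (s := {k : ℕ | 0 < p k}) ⟨0, hp⟩ ⟨d, hd.1⟩
  rwa [hd.csSup_eq ⟨0, hp⟩] at h

theorem HasUnboundedDegrees.exists_ge (h : HasUnboundedDegrees p) (m : ℕ) : ∃ n ≥ m, 0 < p n := by
  by_contra! hcon
  refine h ⟨m, fun n hn => ?_⟩
  by_contra! hmn
  exact absurd hn (hcon n hmn.le).not_gt

theorem inftyEvent_pos_of_unbounded {k : ℕ} (hp : 0 < p 0)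
    (hst : ∀ᵐ c ∂(offspringLaw p), RootInfinite c → Set.Iio k ⊆ rootOptionValues c)
    (hnst : 0 < offspringLaw p {c | RootInfinite c ∧ ¬ Set.Iic k ⊆ rootOptionValues c})
    (hunb : HasUnboundedDegrees p) {A : Set ℕ} (hA : A.Finite) (hkA : Set.Iio k ⊆ A) :
    0 < offspringLaw p (inftyEvent A) := by
  lift A to Finset ℕ using hA
  obtain ⟨n, hn, hpn⟩ := hunb.exists_ge (A.card + 1)
  exact inftyEvent_pos hp hst hnst hkA hpn hn fun a _ => hunb.exists_ge a

theorem inftyEvent_pos_iff {k : ℕ} (hp : 0 < p 0)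
    (hst : ∀ᵐ c ∂(offspringLaw p), RootInfinite c → Set.Iio k ⊆ rootOptionValues c)
    (hnst : 0 < offspringLaw p {c | RootInfinite c ∧ ¬ Set.Iic k ⊆ rootOptionValues c})
    {d : ℕ} (hd : HasMaxOutDegree p d) (A : Set ℕ) :
    0 < offspringLaw p (inftyEvent A) ↔ Set.Iio k ⊆ A ∧ A ⊆ Set.Iic d ∧ A.ncard + 1 ≤ d := by
  constructor
  · intro hpos
    -- An event of positive probability contains a tree with all the almost sure properties, to
    -- which the deterministic bounds apply.
    obtain ⟨c, ⟨hinf, rfl⟩, hst, hdeg⟩ :=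
      ((frequently_ae_mem_iff.mpr hpos.ne').and_eventually (hst.and (ae_degree_le hd))).exists
    refine ⟨hst hinf, fun a ha => ?_, hinf.ncard_lt_degree.trans (hdeg [])⟩
    obtain ⟨i, -, hi⟩ := mem_rootOptionValues.mp ha
    exact hi.le_degree.trans (hdeg _)
  · rintro ⟨hkA, hAd, hcard⟩
    lift A to Finset ℕ using (Set.finite_Iic d).subset hAd
    rw [Set.ncard_coe_finset] at hcard
    exact inftyEvent_pos hp hst hnst hkA (hd.pos hp) hcard fun a ha => ⟨d, hAd ha, hd.pos hp⟩

/-! #### Galton-Watson trees on an arbitrary probability space -/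

section Transfer

variable {Ω : Type*} [MeasurableSpace Ω] {P : Measure Ω} {ξ : List ℕ → Ω → ℕ}

theorem IsOffspringFamily.measurable_family (hξ : IsOffspringFamily P p ξ) :
    Measurable fun ω v => ξ v ω :=
  measurable_pi_lambda _ hξ.measurable

theorem IsOffspringFamily.map_eq (hξ : IsOffspringFamily P p ξ) :
    P.map (fun ω v => ξ v ω) = offspringLaw p := by
  rw [hξ.indep.map_fun_eq_infinitePi_map hξ.measurable]
  exact congrArg _ (funext hξ.law)

theorem IsOffspringFamily.measure_preimage (hξ : IsOffspringFamily P p ξ)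
    {S : Set (List ℕ → ℕ)} (hS : MeasurableSet S) :
    P {ω | (fun v => ξ v ω) ∈ S} = offspringLaw p S := by
  rw [← hξ.map_eq, Measure.map_apply hξ.measurable_family hS]
  rfl

theorem IsOffspringFamily.measure_sg_eq (hξ : IsOffspringFamily P p ξ) (A : Set ℕ) :
    P {ω | sg (tree (fun v => ξ v ω)) (root _) = .infty A} = offspringLaw p (inftyEvent A) := by
  rw [← hξ.measure_preimage (measurableSet_inftyEvent A)]
  simp only [mem_inftyEvent]

theorem measurableSet_not_Iic_subset (k : ℕ) :
    MeasurableSet {c | RootInfinite c ∧ ¬ Set.Iic k ⊆ rootOptionValues c} :=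
  measurableSet_setOfPred.mpr (measurable_rootInfinite.and (Measurable.forall fun a =>
    measurable_const.imp (measurable_mem_rootOptionValues a)).not)

theorem measurableSet_Iio_subset (k : ℕ) :
    MeasurableSet {c | RootInfinite c → Set.Iio k ⊆ rootOptionValues c} :=
  measurableSet_setOfPred.mpr (measurable_rootInfinite.imp (Measurable.forall fun a =>
    measurable_const.imp (measurable_mem_rootOptionValues a)))

/-- Monotonicity of the outer measure suffices, so the draw event need not be shown measurable. -/
theorem IsOffspringFamily.not_Iic_zero_subset_pos (hξ : IsOffspringFamily P p ξ)
    (h : 0 < P {ω | IsDraw (tree (fun v => ξ v ω)) (root _)}) :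
    0 < offspringLaw p {c | RootInfinite c ∧ ¬ Set.Iic 0 ⊆ rootOptionValues c} := by
  rw [← hξ.measure_preimage (measurableSet_not_Iic_subset 0)]
  refine h.trans_le (measure_mono fun ω hω => ?_)
  obtain ⟨h₁, h₂⟩ := IsDraw.hasInfiniteRank (locallyFinite_tree _) hω
  exact ⟨h₁, fun h => h₂ (h (Set.mem_Iic.mpr le_rfl))⟩

/-- Instability is witnessed at one of countably many labels `u`, and the subtree at `u` has the law
of the whole tree, so it can be witnessed at the root. -/
theorem IsOffspringFamily.not_Iic_subset_pos (hξ : IsOffspringFamily P p ξ) {k : ℕ}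
    (h : 0 < P {ω | ¬ IsStable (tree (fun v => ξ v ω)) k}) :
    0 < offspringLaw p {c | RootInfinite c ∧ ¬ Set.Iic k ⊆ rootOptionValues c} := by
  by_contra hcon
  have hS := measurableSet_not_Iic_subset k
  refine h.ne' (measure_mono_null ?_ (measure_iUnion_null (s := fun u : List ℕ =>
    {ω | (fun v => ξ v ω) ∈ subtree u ⁻¹' {c | RootInfinite c ∧ ¬ Set.Iic k ⊆ rootOptionValues c}})
    fun u => ?_))
  · intro ω hω
    simp only [LoopyGame.IsStable, Set.mem_ofPred_eq, not_forall] at hω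
    obtain ⟨x, A, hx, hA⟩ := hω
    obtain ⟨h₁, h₂⟩ := sg_tree_eq_infty_iff.mp hx
    exact Set.mem_iUnion.mpr ⟨x, h₁, h₂ ▸ hA⟩
  · rw [hξ.measure_preimage (measurable_subtree u hS), offspringLaw_preimage_subtree p u hS]
    exact not_lt.mp hcon |> le_zero_iff.mp

theorem IsOffspringFamily.ae_Iio_subset (hξ : IsOffspringFamily P p ξ) {k : ℕ}
    (h : ∀ᵐ ω ∂P, IsStable (tree (fun v => ξ v ω)) (k - 1)) :
    ∀ᵐ c ∂(offspringLaw p), RootInfinite c → Set.Iio k ⊆ rootOptionValues c := by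
  rw [← hξ.map_eq, ae_map_iff hξ.measurable_family.aemeasurable (measurableSet_Iio_subset k)]
  filter_upwards [h] with ω hω hinf a ha
  -- The truncated `k - 1` is harmless: `a < k` forces `k ≥ 1`.
  exact hω _ _ (mem_inftyEvent.mp ⟨hinf, rfl⟩) (Set.mem_Iic.mpr (Nat.le_sub_one_of_lt ha))

end Transfer

end GaltonWatson

theorem mainTheorem6 {Ω : Type*} [MeasurableSpace Ω] (P : Measure Ω) [IsProbabilityMeasure P]
    (p : PMF ℕ) (hp : 0 < p 0) (ξ : List ℕ → Ω → ℕ)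
    (hξ : GaltonWatson.IsOffspringFamily P p ξ) :
    -- (a) positive probability of a draw
    (0 < P {ω | LoopyGame.IsDraw (GaltonWatson.tree (fun v => ξ v ω)) (GaltonWatson.root _)} →
      (GaltonWatson.HasUnboundedDegrees p → ∀ A : Set ℕ, A.Finite →
        0 < P {ω | LoopyGame.sg (GaltonWatson.tree (fun v => ξ v ω)) (GaltonWatson.root _)
          = .infty A}) ∧
      (∀ d : ℕ, GaltonWatson.HasMaxOutDegree p d → ∀ A : Set ℕ,
        (0 < P {ω | LoopyGame.sg (GaltonWatson.tree (fun v => ξ v ω)) (GaltonWatson.root _)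
          = .infty A} ↔
          A ⊆ Set.Iic d ∧ A.ncard + 1 ≤ d))) ∧
    -- (b) almost surely `(k - 1)`-stable, but not almost surely `k`-stable
    (∀ k : ℕ, 1 ≤ k →
      (∀ᵐ ω ∂P, LoopyGame.IsStable (GaltonWatson.tree (fun v => ξ v ω)) (k - 1)) →
      0 < P {ω | ¬ LoopyGame.IsStable (GaltonWatson.tree (fun v => ξ v ω)) k} →
      (GaltonWatson.HasUnboundedDegrees p → ∀ A : Set ℕ, A.Finite → Set.Iio k ⊆ A →
        0 < P {ω | LoopyGame.sg (GaltonWatson.tree (fun v => ξ v ω)) (GaltonWatson.root _)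
          = .infty A}) ∧
      (∀ d : ℕ, GaltonWatson.HasMaxOutDegree p d → ∀ A : Set ℕ,
        (0 < P {ω | LoopyGame.sg (GaltonWatson.tree (fun v => ξ v ω)) (GaltonWatson.root _)
          = .infty A} ↔
          Set.Iio k ⊆ A ∧ A ⊆ Set.Iic d ∧ A.ncard + 1 ≤ d))) := by
  simp only [hξ.measure_sg_eq]
  refine ⟨fun hdraw => ?_, fun k _ hst hnst => ?_⟩
  -- Part (a) is the case `k = 0`, in which the stability assumption is vacuous.
  · have hst : ∀ᵐ c ∂(GaltonWatson.offspringLaw p), GaltonWatson.RootInfinite c →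
        Set.Iio 0 ⊆ GaltonWatson.rootOptionValues c := by simp
    have hnst := hξ.not_Iic_zero_subset_pos hdraw
    refine ⟨fun hunb A hA =>
      GaltonWatson.inftyEvent_pos_of_unbounded hp hst hnst hunb hA (by simp), fun d hd A => ?_⟩
    rw [GaltonWatson.inftyEvent_pos_iff hp hst hnst hd]
    simp
  · have hst' := hξ.ae_Iio_subset hst
    have hnst' := hξ.not_Iic_subset_pos hnst
    exact ⟨fun hunb A hA hkA =>
      GaltonWatson.inftyEvent_pos_of_unbounded hp hst' hnst' hunb hA hkA,
      fun d hd A => GaltonWatson.inftyEvent_pos_iff hp hst' hnst' hd A⟩
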